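/- Let $I\subset\mathbb R$ be a bounded interval and let $a$ be a proper impedance on $I$, that is, $a$ is a positive measurable function on $I$ with $a\in L^2(I)$ and $1/a\in L^2(I)$. Fix $x_0\in\overline I$ and define the formal powers $\{\varphi_a^{(k)}\}_{k\ge 0}$ associated with $a$ and centered at $x_0$ by \[ \varphi_a^{(0)}(x)=1,\qquad \varphi_a^{(1)}(x)=\int_{x_0}^x\frac{dt}{a^2(t)},\qquad \varphi_a^{(k)}(x)=k(k-1)\int_{x_0}^x\frac{1}{a^2(t)}\left(\int_{x_0}^t a^2(s)\,\varphi_a^{(k-2)}(s)\,ds\right)dt\quad(k\ge 2). \] For $1\le p<\infty$ let $L^p_a(I)$ be the Banach space of (classes of) complex-valued measurable functions $u$ on $I$ with norm $\|u\|_{L^p_a(I)}=\left(\int_I|u(x)|^p a^2(x)\,dx\right)^{1/p}<\infty$. Then for every $1\le p<\infty$ the formal powers $\{\varphi_a^{(k)}\}_{k\ge 0}$ form a complete system in $L^p_a(I)$: each $\varphi_a^{(k)}$ belongs to $L^p_a(I)$, and the set of their finite linear combinations with complex coefficients is dense in $L^p_a(I)$. -/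

import Mathlib

open MeasureTheory
open scoped ENNReal

noncomputable section

/-- `a` is a proper impedance on `I`: a positive measurable function (everything up to null sets)
with `a ∈ L²(I)` and `1/a ∈ L²(I)`. Measurability is part of `MemLp`. -/
structure IsProperImpedance (I : Set ℝ) (a : ℝ → ℝ) : Prop where
  pos : ∀ᵐ x ∂(volume.restrict I), 0 < a x
  memLp : MemLp a 2 (volume.restrict I)
  memLp_inv : MemLp (fun x => 1 / a x) 2 (volume.restrict I)

/-- The measure `a²(x) dx` on `I`; the weighted space `L^p_a(I)` is `Lp ℂ p (impedanceMeasure I a)`. -/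
def impedanceMeasure (I : Set ℝ) (a : ℝ → ℝ) : Measure ℝ :=
  (volume.restrict I).withDensity (fun x => ENNReal.ofReal (a x ^ 2))

/-- The operator `J_a v (x) = ∫_{x₀}^x v(t) / a²(t) dt`. -/
def impedanceJ (a : ℝ → ℝ) (x₀ : ℝ) (v : ℝ → ℂ) (x : ℝ) : ℂ :=
  ∫ t in x₀..x, v t / ((a t ^ 2 : ℝ) : ℂ)

/-- The operator `R_a = J_a J_{1/a}`, that is,
`R_a v (x) = ∫_{x₀}^x (1 / a²(t)) ∫_{x₀}^t a²(s) v(s) ds dt`. -/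
def impedanceR (a : ℝ → ℝ) (x₀ : ℝ) (v : ℝ → ℂ) : ℝ → ℂ :=
  impedanceJ a x₀ (impedanceJ (fun t => 1 / a t) x₀ v)

/-- The formal powers `φ_a^{(k)}` associated with `a`, centered at `x₀`:
`φ^{(0)} = 1`, `φ^{(1)} = J_a[1]`, `φ^{(k)} = k (k - 1) R_a φ^{(k-2)}` for `k ≥ 2`. -/
def formalPower (a : ℝ → ℝ) (x₀ : ℝ) : ℕ → ℝ → ℂ
  | 0 => fun _ => 1
  | 1 => impedanceJ a x₀ (fun _ => 1)
  | k + 2 => fun x => ((k : ℂ) + 2) * ((k : ℂ) + 1) * impedanceR a x₀ (formalPower a x₀ k) x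

/-- A sequence of vectors of a complex normed space is a complete system if its (finite) linear
span is dense. -/
def IsCompleteSystem {X : Type*} [NormedAddCommGroup X] [NormedSpace ℂ X] (u : ℕ → X) : Prop :=
  Dense (Submodule.span ℂ (Set.range u) : Set X)

end

/-!
Write `dm = a² dx` and `dn = dx / a²` on `I`; both are finite measures without atoms, and they have
the same null sets. On `closure I` the formal power of order `k` is `k!` times the `k`-th iterated
integral of `1` based at `x₀`, integrated alternately against `m` and `n` with `n` outermost
(`formalPower_eq_factorial_mul_iterIntegral`). Exchanging `m` and `n` gives a dual family, and
`h ↦ ∫_{x₀}^x h dn` carries the dual family into the original one.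

*Density in `L²(m)`*, for any two such measures with `m ≪ n`. Let `Q` be the Volterra operator
`f ↦ ∫_{(-∞, x]} ∫_{(-∞, t]} f dm dn(t)`, and let `f ∈ L²(m)` have vanishing moments against all
iterated integrals. Against such `f` the operator `Q` is symmetric
(`MomentsVanish.integral_volterra_mul`): the boundary terms in Fubini's theorem are the moments of
orders `0` and `1`. Since `Q` maps every iterated integral into the span of iterated integrals,
`Q f` again has vanishing moments. Hence `s_k = ‖Q^k f‖` satisfies `s_{k+1}² ≤ s_k s_{k+2}`, so
unless `s_1 = 0` it is bounded below by a geometric sequence; but `Q` is Volterra, so `s_k` decays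
factorially (`norm_iterate_volterra_le`, `iterMass_le`). Therefore `Q f = 0`, whence
`∫ |F|² dn = -∫ Q f · conj f dm = 0` for `F x = ∫_{(-∞, x]} f dm`, so `F = 0` and `f = 0`.

*Density in `L^p(m)`.* By the first part applied to the dual family, and since
`h ↦ ∫_{x₀}^x h dn` is continuous from `L²(n)` to `L^p(m)`, the closed span of the formal powers
contains all these primitives (`primitive_mem_closure_span_iterIntegral`). Taking `h = g' a²` gives
every `g` in `C_c^∞`, up to a constant, and such functions are dense in `L^p(m)`.
-/

/-! ### Cumulative integrals -/

section Cumulative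

variable {E : Type*} [NormedAddCommGroup E] [NormedSpace ℝ E]

/-- The cumulative integral `x ↦ ∫_{(-∞, x]} f dμ`. -/
noncomputable def cumul (μ : Measure ℝ) (f : ℝ → E) (x : ℝ) : E := ∫ t in Set.Iic x, f t ∂μ

variable {μ : Measure ℝ} {f : ℝ → E}

theorem cumul_eq_add_intervalIntegral (hf : Integrable f μ) (x y : ℝ) :
    cumul μ f y = cumul μ f x + ∫ t in x..y, f t ∂μ := by
  rw [← intervalIntegral.integral_Iic_sub_Iic hf.integrableOn hf.integrableOn]
  simp [cumul]

theorem continuous_cumul [NullSingletonClass μ] (hf : Integrable f μ) :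
    Continuous (cumul μ f) := by
  have : cumul μ f = fun y => cumul μ f 0 + ∫ t in (0 : ℝ)..y, f t ∂μ :=
    funext fun y => cumul_eq_add_intervalIntegral hf 0 y
  rw [this]
  exact continuous_const.add (hf.continuous_primitive 0)

theorem norm_cumul_le_integral_norm (hf : Integrable f μ) (x : ℝ) :
    ‖cumul μ f x‖ ≤ ∫ t, ‖f t‖ ∂μ :=
  (norm_integral_le_integral_norm _).trans
    (setIntegral_le_integral hf.norm (Filter.Eventually.of_forall fun _ => norm_nonneg _))

theorem integrable_cumul [NullSingletonClass μ] (ν : Measure ℝ) [IsFiniteMeasure ν]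
    (hf : Integrable f μ) : Integrable (cumul μ f) ν :=
  .of_bound (continuous_cumul hf).aestronglyMeasurable _
    (Filter.Eventually.of_forall (norm_cumul_le_integral_norm hf))

theorem memLp_cumul [NullSingletonClass μ] (ν : Measure ℝ) [IsFiniteMeasure ν] (p : ℝ≥0∞)
    (hf : Integrable f μ) : MemLp (cumul μ f) p ν :=
  .of_bound (continuous_cumul hf).aestronglyMeasurable _
    (Filter.Eventually.of_forall (norm_cumul_le_integral_norm hf))

theorem setIntegral_Ici_eq_sub_cumul [NullSingletonClass μ] (hf : Integrable f μ) (t : ℝ) :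
    ∫ x in Set.Ici t, f x ∂μ = ∫ x, f x ∂μ - cumul μ f t := by
  rw [eq_sub_iff_add_eq', integral_Ici_eq_integral_Ioi, cumul]
  exact intervalIntegral.integral_Iic_add_Ioi hf.integrableOn hf.integrableOn

end Cumulative

/-! ### Fubini's theorem for cumulative integrals -/

section Fubini

variable {𝕜 : Type*} [RCLike 𝕜]

/-- Summation by parts for cumulative integrals, which is Fubini's theorem on `{t ≤ x}`. -/
theorem integral_cumul_mul {m n : Measure ℝ} [IsFiniteMeasure m] [IsFiniteMeasure n]
    [NullSingletonClass m] {f g : ℝ → 𝕜} (hf : Integrable f n) (hg : Integrable g m) :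
    ∫ x, cumul n f x * g x ∂m = ∫ t, f t * (∫ x, g x ∂m - cumul m g t) ∂n := by
  have hprod : Integrable (Function.uncurry fun x t => g x * f t) (m.prod n) := hg.mul_prod hf
  have hS : MeasurableSet {z : ℝ × ℝ | z.2 ≤ z.1} :=
    measurableSet_le measurable_snd measurable_fst
  have hswap := integral_integral_swap
    (f := fun x t => ({z : ℝ × ℝ | z.2 ≤ z.1}.indicator
      (Function.uncurry fun x t => g x * f t)) (x, t)) (hprod.indicator hS)
  have hl : ∀ x, ∫ t, ({z : ℝ × ℝ | z.2 ≤ z.1}.indicator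
      (Function.uncurry fun x t => g x * f t)) (x, t) ∂n = cumul n f x * g x := by
    intro x
    rw [cumul, mul_comm, ← integral_const_mul, ← integral_indicator measurableSet_Iic]
    rfl
  have hr : ∀ t, ∫ x, ({z : ℝ × ℝ | z.2 ≤ z.1}.indicator
      (Function.uncurry fun x t => g x * f t)) (x, t) ∂m
        = f t * (∫ x, g x ∂m - cumul m g t) := by
    intro t
    rw [← setIntegral_Ici_eq_sub_cumul hg, ← integral_const_mul,
      ← integral_indicator measurableSet_Ici]
    congr 1
    ext x
    simp only [Set.indicator, Set.mem_ofPred_eq, Set.mem_Ici, Function.uncurry, mul_comm]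
  simpa only [hl, hr] using hswap

/-- The product rule for primitives with respect to an atomless measure. -/
theorem cumul_mul_cumul {n : Measure ℝ} [IsFiniteMeasure n] [NullSingletonClass n]
    {f g : ℝ → 𝕜} (hf : Integrable f n) (hg : Integrable g n) (x : ℝ) :
    cumul n f x * cumul n g x
      = cumul n (fun t => f t * cumul n g t) x + cumul n (fun t => cumul n f t * g t) x := by
  -- Apply Fubini's theorem to the restriction of `n` to `(-∞, x]`, which has the same cumulative
  -- integrals up to `x`.
  have hres : ∀ h : ℝ → 𝕜, ∀ t ∈ Set.Iic x, cumul (n.restrict (Set.Iic x)) h t = cumul n h t := by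
    intro h t ht
    rw [cumul, Measure.restrict_restrict measurableSet_Iic,
      Set.inter_eq_left.2 (Set.Iic_subset_Iic.2 ht), cumul]
  have key := integral_cumul_mul (m := n.restrict (Set.Iic x)) (n := n.restrict (Set.Iic x))
    hf.restrict hg.restrict
  have hl := setIntegral_congr_fun (μ := n) (s := Set.Iic x) measurableSet_Iic
    (f := fun t => cumul (n.restrict (Set.Iic x)) f t * g t) (g := fun t => cumul n f t * g t)
    fun t ht => by simp only [hres f t ht]
  have hr := setIntegral_congr_fun (μ := n) (s := Set.Iic x) measurableSet_Iic
    (f := fun t => f t * (∫ x in Set.Iic x, g x ∂n - cumul (n.restrict (Set.Iic x)) g t))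
    (g := fun t => f t * cumul n g x - f t * cumul n g t)
    fun t ht => by simp only [hres g t ht, mul_sub]; rfl
  rw [hl, hr] at key
  have hfG : Integrable (fun t => f t * cumul n g t) n :=
    hf.mul_bdd (continuous_cumul hg).aestronglyMeasurable
      (Filter.Eventually.of_forall (norm_cumul_le_integral_norm hg))
  rw [integral_sub (hf.mul_const _).restrict hfG.restrict, integral_mul_const] at key
  change cumul n _ x = cumul n f x * cumul n g x - cumul n _ x at key
  rw [key]
  ring

end Fubini

/-! ### Masses of ordered simplices -/

section IteratedMass

/-- The mass of the ordered simplex `{t₁ ≤ ⋯ ≤ t_k ≤ x}` under the `k`-th power of `n`. -/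
noncomputable def iterMass (n : Measure ℝ) : ℕ → ℝ → ℝ
  | 0 => fun _ => 1
  | k + 1 => cumul n (iterMass n k)

theorem iterMass_nonneg (n : Measure ℝ) : ∀ k x, 0 ≤ iterMass n k x
  | 0, _ => zero_le_one
  | k + 1, _ => integral_nonneg (iterMass_nonneg n k)

variable (n : Measure ℝ) [IsFiniteMeasure n] [NullSingletonClass n]

theorem integrable_iterMass (ν : Measure ℝ) [IsFiniteMeasure ν] :
    ∀ k, Integrable (iterMass n k) ν
  | 0 => integrable_const _
  | k + 1 => integrable_cumul ν (integrable_iterMass n k)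

theorem monotone_iterMass : ∀ k, Monotone (iterMass n k)
  | 0 => fun _ _ _ => le_rfl
  | k + 1 => fun _ _ h => setIntegral_mono_set (integrable_iterMass n n k).integrableOn
      (Filter.Eventually.of_forall (iterMass_nonneg n k)) (Set.Iic_subset_Iic.2 h).eventuallyLE

/-- The product of a `k`-simplex and an interval splits into `k + 1` copies of the
`(k + 1)`-simplex. -/
theorem succ_mul_iterMass (x : ℝ) :
    ∀ k : ℕ, (k + 1 : ℝ) * iterMass n (k + 1) x = iterMass n 1 x * iterMass n k x := by
  intro k
  induction k generalizing x with
  | zero => simp [iterMass]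
  | succ k ih =>
    have h := cumul_mul_cumul (integrable_iterMass n n 0) (integrable_iterMass n n k) x
    have h2 : cumul n (fun t => cumul n (iterMass n 0) t * iterMass n k t) x
        = (k + 1 : ℝ) * iterMass n (k + 2) x := by
      rw [show (fun t => cumul n (iterMass n 0) t * iterMass n k t)
        = fun t => (k + 1 : ℝ) * iterMass n (k + 1) t from funext fun t => (ih t).symm]
      exact integral_const_mul _ _
    have h1 : cumul n (fun t => iterMass n 0 t * cumul n (iterMass n k) t) x
        = iterMass n (k + 2) x := by
      simp [iterMass]
    rw [h1, h2] at h
    change _ = cumul n (iterMass n 0) x * cumul n (iterMass n k) x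
    rw [h]
    push_cast
    ring

/-- Factorial decay of the simplex masses; it makes the Volterra operator quasinilpotent. -/
theorem iterMass_le (k : ℕ) (x : ℝ) : iterMass n k x ≤ n.real Set.univ ^ k / k.factorial := by
  induction k with
  | zero => simp [iterMass]
  | succ k ih =>
    have h1 : iterMass n 1 x ≤ n.real Set.univ := by
      simpa [iterMass, cumul] using measureReal_mono (μ := n) (Set.subset_univ (Set.Iic x))
    have h := succ_mul_iterMass n x k
    have hk : (0 : ℝ) < k + 1 := by positivity
    rw [mul_comm, ← eq_div_iff hk.ne'] at h
    rw [h, Nat.factorial_succ, pow_succ, Nat.cast_mul, mul_comm ((k + 1 : ℕ) : ℝ), ← div_div]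
    push_cast
    gcongr
    rw [mul_comm, mul_div_right_comm]
    exact mul_le_mul ih h1 (iterMass_nonneg n 1 x) (by positivity)

end IteratedMass

/-! ### The Volterra operator -/

section Volterra

/-- The Volterra operator `f ↦ ∫_{(-∞, x]} ∫_{(-∞, t]} f dm dn(t)`. -/
noncomputable def volterra (m n : Measure ℝ) (f : ℝ → ℂ) : ℝ → ℂ := cumul n (cumul m f)

/-- The iterated integrals of `1` based at `x₀`, alternating between the two measures, the
outermost integral being with respect to `n`. -/
noncomputable def iterIntegral (x₀ : ℝ) : Measure ℝ → Measure ℝ → ℕ → ℝ → ℂ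
  | _, _, 0 => fun _ => 1
  | m, n, k + 1 => fun x => ∫ t in x₀..x, iterIntegral x₀ n m k t ∂n

variable {m n : Measure ℝ} [IsFiniteMeasure m] [IsFiniteMeasure n]
  [NullSingletonClass m] [NullSingletonClass n] {f g : ℝ → ℂ}

omit [IsFiniteMeasure m] in
theorem memLp_volterra (ν : Measure ℝ) [IsFiniteMeasure ν] (p : ℝ≥0∞) (hf : Integrable f m) :
    MemLp (volterra m n f) p ν :=
  memLp_cumul ν p (integrable_cumul n hf)

omit [IsFiniteMeasure m] [NullSingletonClass m] in
theorem norm_cumul_le {u : ℝ → ℝ} (hu : Integrable u m) (h : ∀ x, ‖f x‖ ≤ u x) (x : ℝ) :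
    ‖cumul m f x‖ ≤ cumul m u x :=
  norm_integral_le_of_norm_le hu.integrableOn (Filter.Eventually.of_forall h)

omit [NullSingletonClass m] in
theorem norm_iterate_volterra_le (hf : Integrable f m) (k : ℕ) (x : ℝ) :
    ‖(volterra m n)^[k + 1] f x‖
      ≤ (∫ t, ‖f t‖ ∂m) * m.real Set.univ ^ k * iterMass n (k + 1) x := by
  induction k generalizing x with
  | zero =>
    have h := norm_cumul_le (m := n) (f := cumul m f) (integrable_const _)
      (norm_cumul_le_integral_norm hf) x
    simpa [iterMass, volterra, cumul, mul_comm] using h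
  | succ k ih =>
    rw [Function.iterate_succ_apply']
    set C := (∫ t, ‖f t‖ ∂m) * m.real Set.univ ^ k with hC
    have hC0 : 0 ≤ C := mul_nonneg (integral_nonneg fun _ => norm_nonneg _) (by positivity)
    have h1 : ∀ t, ‖cumul m ((volterra m n)^[k + 1] f) t‖
        ≤ C * m.real Set.univ * iterMass n (k + 1) t := by
      intro t
      have hle : ∀ s ∈ Set.Iic t, ‖(volterra m n)^[k + 1] f s‖ ≤ C * iterMass n (k + 1) t :=
        fun s hs => (ih s).trans (mul_le_mul_of_nonneg_left (monotone_iterMass n _ hs) hC0)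
      refine (norm_setIntegral_le_of_norm_le_const (measure_lt_top _ _) hle).trans ?_
      rw [mul_right_comm]
      refine mul_le_mul_of_nonneg_right ?_ (iterMass_nonneg n _ _)
      exact mul_le_mul_of_nonneg_left (measureReal_mono (μ := m) (Set.subset_univ (Set.Iic t))) hC0
    refine (norm_cumul_le ((integrable_iterMass n n (k + 1)).const_mul _) h1 x).trans_eq ?_
    rw [pow_succ, ← mul_assoc, ← hC]
    exact integral_const_mul _ _

omit [NullSingletonClass n] in
/-- Between functions `f` orthogonal to the two solutions `1` and `x ↦ n((-∞, x])` of the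
homogeneous equation and arbitrary functions `g`, the Volterra operator is symmetric. -/
theorem integral_volterra_mul_comm (hf : Integrable f m) (hg : Integrable g m)
    (hf0 : ∫ x, f x ∂m = 0) (hf1 : ∫ x, cumul n (fun _ => (1 : ℂ)) x * f x ∂m = 0) :
    ∫ x, volterra m n f x * g x ∂m = ∫ x, volterra m n g x * f x ∂m := by
  have hF := integrable_cumul n hf
  have hG := integrable_cumul n hg
  have hFG : Integrable (fun t => cumul m f t * cumul m g t) n :=
    hF.mul_bdd (continuous_cumul hg).aestronglyMeasurable
      (Filter.Eventually.of_forall (norm_cumul_le_integral_norm hg))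
  have h1 : ∫ t, cumul m f t ∂n = 0 := by
    rw [integral_cumul_mul (integrable_const _) hf, hf0] at hf1
    simpa [integral_neg] using hf1
  rw [volterra, volterra, integral_cumul_mul hF hg, integral_cumul_mul hG hf, hf0]
  simp_rw [mul_sub, mul_zero, zero_sub]
  rw [integral_sub (hF.mul_const _) hFG, integral_mul_const, h1, zero_mul, zero_sub, integral_neg]
  simp_rw [mul_comm]

omit [NullSingletonClass n] in
/-- The quadratic form of the Volterra operator is nonpositive on functions of mean zero. -/
theorem integral_volterra_mul_conj (hf : Integrable f m) (hf0 : ∫ x, f x ∂m = 0) :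
    ∫ x, volterra m n f x * (starRingEnd ℂ) (f x) ∂m
      = -((∫ t, ‖cumul m f t‖ ^ 2 ∂n : ℝ) : ℂ) := by
  have hconj : ∀ t, cumul m (fun x => (starRingEnd ℂ) (f x)) t
      = (starRingEnd ℂ) (cumul m f t) := fun t => integral_conj
  have hfc : Integrable (fun x => (starRingEnd ℂ) (f x)) m :=
    (LinearIsometryEquiv.integrable_comp_iff (RCLike.conjLIE (K := ℂ))).2 hf
  rw [volterra, integral_cumul_mul (integrable_cumul n hf) hfc]
  simp_rw [hconj]
  rw [integral_conj, hf0, map_zero]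
  simp_rw [zero_sub, mul_neg, Complex.mul_conj', integral_neg]
  rw [← integral_complex_ofReal]
  norm_cast

end Volterra

/-! ### Iterated integrals -/

section IterIntegral

variable {x₀ : ℝ}

theorem continuous_iterIntegral_and_bounded (m n : Measure ℝ) [IsFiniteMeasure m]
    [IsFiniteMeasure n] [NullSingletonClass m] [NullSingletonClass n] (k : ℕ) :
    Continuous (iterIntegral x₀ m n k) ∧ ∃ C, ∀ x, ‖iterIntegral x₀ m n k x‖ ≤ C := by
  induction k generalizing m n with
  | zero => exact ⟨continuous_const, 1, fun x => by simp [iterIntegral]⟩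
  | succ k ih =>
    obtain ⟨hc, C, hC⟩ := ih n m
    have hi : Integrable (iterIntegral x₀ n m k) n :=
      .of_bound hc.aestronglyMeasurable C (Filter.Eventually.of_forall hC)
    refine ⟨hi.continuous_primitive x₀, ∫ t, ‖iterIntegral x₀ n m k t‖ ∂n, fun x => ?_⟩
    exact intervalIntegral.norm_integral_le_integral_norm_uIoc.trans
      (setIntegral_le_integral hi.norm (Filter.Eventually.of_forall fun _ => norm_nonneg _))

variable {m n : Measure ℝ} [IsFiniteMeasure m] [IsFiniteMeasure n]
  [NullSingletonClass m] [NullSingletonClass n]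

theorem memLp_iterIntegral (ν : Measure ℝ) [IsFiniteMeasure ν] (p : ℝ≥0∞) (k : ℕ) :
    MemLp (iterIntegral x₀ m n k) p ν := by
  obtain ⟨hc, C, hC⟩ := continuous_iterIntegral_and_bounded (x₀ := x₀) m n k
  exact .of_bound hc.aestronglyMeasurable C (Filter.Eventually.of_forall hC)

theorem integrable_iterIntegral (ν : Measure ℝ) [IsFiniteMeasure ν] (k : ℕ) :
    Integrable (iterIntegral x₀ m n k) ν :=
  memLp_one_iff_integrable.1 (memLp_iterIntegral ν 1 k)

/-- The Volterra operator based at `-∞` and the double integral based at `x₀` differ by an element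
of the span of the first two iterated integrals. -/
theorem volterra_iterIntegral (k : ℕ) (x : ℝ) :
    volterra m n (iterIntegral x₀ m n k) x
      = volterra m n (iterIntegral x₀ m n k) x₀
        + cumul m (iterIntegral x₀ m n k) x₀ * iterIntegral x₀ m n 1 x
        + iterIntegral x₀ m n (k + 2) x := by
  have hi := integrable_iterIntegral (x₀ := x₀) (m := m) (n := n) m k
  have hi' := integrable_iterIntegral (x₀ := x₀) (m := n) (n := m) n (k + 1)
  rw [volterra, cumul_eq_add_intervalIntegral (integrable_cumul n hi) x₀ x]
  rw [intervalIntegral.integral_congr (g := fun t => cumul m (iterIntegral x₀ m n k) x₀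
      + iterIntegral x₀ n m (k + 1) t) fun t _ => cumul_eq_add_intervalIntegral hi x₀ t,
    intervalIntegral.integral_add (intervalIntegrable_const)
    (hi'.intervalIntegrable : IntervalIntegrable (iterIntegral x₀ n m (k + 1)) n x₀ x), add_assoc]
  congr 2
  simp only [iterIntegral]
  rw [← intervalIntegral.integral_const_mul, mul_one]

end IterIntegral

/-! ### Functions with vanishing moments -/

section Orthogonality

variable (x₀ : ℝ) (m n : Measure ℝ)

/-- The square-integrable functions with respect to `m` all of whose moments against the iterated
integrals vanish. -/
def MomentsVanish (f : ℝ → ℂ) : Prop :=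
  MemLp f 2 m ∧ ∀ k, ∫ x, iterIntegral x₀ m n k x * f x ∂m = 0

variable {x₀ m n} [IsFiniteMeasure m] [IsFiniteMeasure n]
  [NullSingletonClass m] [NullSingletonClass n] {f : ℝ → ℂ}

omit [IsFiniteMeasure n] [NullSingletonClass m] [NullSingletonClass n] in
theorem MomentsVanish.integrable (hf : MomentsVanish x₀ m n f) : Integrable f m :=
  hf.1.integrable one_le_two

omit [IsFiniteMeasure m] [IsFiniteMeasure n] [NullSingletonClass m] [NullSingletonClass n] in
theorem MomentsVanish.integral_eq_zero (hf : MomentsVanish x₀ m n f) : ∫ x, f x ∂m = 0 := by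
  simpa [iterIntegral] using hf.2 0

theorem MomentsVanish.integral_cumul_one_mul (hf : MomentsVanish x₀ m n f) :
    ∫ x, cumul n (fun _ => (1 : ℂ)) x * f x ∂m = 0 := by
  have hP : Integrable (fun x => iterIntegral x₀ m n 1 x * f x) m := by
    obtain ⟨hc, C, hC⟩ := continuous_iterIntegral_and_bounded (x₀ := x₀) m n 1
    exact hf.integrable.bdd_mul hc.aestronglyMeasurable (Filter.Eventually.of_forall hC)
  have h : ∀ x, cumul n (fun _ => (1 : ℂ)) x
      = cumul n (fun _ => (1 : ℂ)) x₀ + iterIntegral x₀ m n 1 x := fun x =>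
    cumul_eq_add_intervalIntegral (integrable_const _) x₀ x
  have hfun : (fun x => cumul n (fun _ => (1 : ℂ)) x * f x) = fun x =>
      cumul n (fun _ => (1 : ℂ)) x₀ * f x + iterIntegral x₀ m n 1 x * f x := by
    ext x
    rw [h x, add_mul]
  rw [hfun, integral_add (hf.integrable.const_mul _) hP, integral_const_mul,
    hf.integral_eq_zero, hf.2 1, mul_zero, add_zero]

theorem MomentsVanish.integral_volterra_mul (hf : MomentsVanish x₀ m n f) {g : ℝ → ℂ}
    (hg : Integrable g m) :
    ∫ x, volterra m n f x * g x ∂m = ∫ x, volterra m n g x * f x ∂m :=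
  integral_volterra_mul_comm hf.integrable hg hf.integral_eq_zero hf.integral_cumul_one_mul

/-- By symmetry the moments of `volterra m n f` are the moments of `f` against the images of the
iterated integrals, which are again combinations of iterated integrals. -/
theorem MomentsVanish.map_volterra (hf : MomentsVanish x₀ m n f) :
    MomentsVanish x₀ m n (volterra m n f) := by
  refine ⟨memLp_volterra m 2 hf.integrable, fun k => ?_⟩
  have hP : ∀ k, Integrable (fun x => iterIntegral x₀ m n k x * f x) m := fun k => by
    obtain ⟨hc, C, hC⟩ := continuous_iterIntegral_and_bounded (x₀ := x₀) m n k
    exact hf.integrable.bdd_mul hc.aestronglyMeasurable (Filter.Eventually.of_forall hC)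
  simp_rw [mul_comm (iterIntegral x₀ m n k _)]
  rw [hf.integral_volterra_mul (integrable_iterIntegral m k)]
  have hfun : (fun x => volterra m n (iterIntegral x₀ m n k) x * f x) = fun x =>
      volterra m n (iterIntegral x₀ m n k) x₀ * f x
        + cumul m (iterIntegral x₀ m n k) x₀ * (iterIntegral x₀ m n 1 x * f x)
        + iterIntegral x₀ m n (k + 2) x * f x := by
    ext x
    rw [volterra_iterIntegral k x]
    ring
  have h0 := hf.integrable.const_mul (volterra m n (iterIntegral x₀ m n k) x₀)
  have h1 := (hP 1).const_mul (cumul m (iterIntegral x₀ m n k) x₀)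
  have h01 := h0.add h1
  rw [hfun]
  calc _ = ∫ x, (volterra m n (iterIntegral x₀ m n k) x₀ * f x
        + cumul m (iterIntegral x₀ m n k) x₀ * (iterIntegral x₀ m n 1 x * f x)) ∂m
        + ∫ x, iterIntegral x₀ m n (k + 2) x * f x ∂m := integral_add h01 (hP (k + 2))
    _ = 0 := by
      rw [integral_add h0 h1, integral_const_mul, integral_const_mul, hf.integral_eq_zero,
        hf.2 1, hf.2 (k + 2)]
      simp

theorem MomentsVanish.iterate_volterra (hf : MomentsVanish x₀ m n f) (k : ℕ) :
    MomentsVanish x₀ m n ((volterra m n)^[k] f) := by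
  induction k with
  | zero => exact hf
  | succ k ih => rw [Function.iterate_succ_apply']; exact ih.map_volterra

/-- A log-convex sequence with factorial decay vanishes from the second term on: log-convexity
gives a geometric lower bound. -/
theorem eq_zero_of_sq_le_mul_of_le_div_factorial {s : ℕ → ℝ} (h0 : ∀ k, 0 ≤ s k)
    (hs : ∀ k, s (k + 1) ^ 2 ≤ s k * s (k + 2)) {A B : ℝ}
    (hd : ∀ k, s (k + 1) ≤ A * (B ^ k / k.factorial)) : s 1 = 0 := by
  by_contra h1
  have hs1 : 0 < s 1 := lt_of_le_of_ne (h0 1) (Ne.symm h1)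
  have hs0 : 0 < s 0 := by
    have h := hs 0
    rcases (h0 0).eq_or_lt with h' | h'
    · rw [← h', zero_mul] at h
      have := pow_pos hs1 2
      simp only [zero_add] at h
      linarith
    · exact h'
  set r := s 1 / s 0 with hr
  have hrpos : 0 < r := div_pos hs1 hs0
  have hpos : ∀ k, 0 < s k ∧ r * s k ≤ s (k + 1) := by
    intro k
    induction k with
    | zero => exact ⟨hs0, by rw [hr, div_mul_cancel₀ _ hs0.ne']⟩
    | succ k ih =>
      have hk1 : 0 < s (k + 1) := (mul_pos hrpos ih.1).trans_le ih.2
      refine ⟨hk1, ?_⟩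
      have h := hs k
      refine le_of_mul_le_mul_left ?_ ih.1
      calc s k * (r * s (k + 1)) = (r * s k) * s (k + 1) := by ring
        _ ≤ s (k + 1) * s (k + 1) := by gcongr; exact ih.2
        _ ≤ s k * s (k + 2) := by rw [← sq]; exact h
  have hgeo : ∀ k, s 1 * r ^ k ≤ s (k + 1) := by
    intro k
    induction k with
    | zero => simp
    | succ k ih =>
      calc s 1 * r ^ (k + 1) = r * (s 1 * r ^ k) := by ring
        _ ≤ r * s (k + 1) := by gcongr
        _ ≤ s (k + 2) := (hpos (k + 1)).2
  have hle : ∀ k, s 1 ≤ A * ((B / r) ^ k / k.factorial) := by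
    intro k
    have h := (hgeo k).trans (hd k)
    rw [← le_div_iff₀ (pow_pos hrpos k)] at h
    refine h.trans_eq ?_
    rw [div_pow]
    ring
  have hlim := (FloorSemiring.tendsto_pow_div_factorial_atTop (B / r)).const_mul A
  rw [mul_zero] at hlim
  exact absurd (ge_of_tendsto' hlim hle) (not_le.2 hs1)

/-- On the orbit of `f` the Volterra operator is symmetric, so the norms of the iterates are
log-convex; being also factorially small, they vanish from the first iterate on. -/
theorem MomentsVanish.volterra_ae_eq_zero (hf : MomentsVanish x₀ m n f) :
    volterra m n f =ᵐ[m] 0 := by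
  have hW := hf.iterate_volterra
  set s : ℕ → ℝ := fun k => ‖(hW k).1.toLp‖ with hsdef
  have hinner : ∀ {u v : ℝ → ℂ} (hu : MemLp u 2 m) (hv : MemLp v 2 m),
      inner ℂ hv.toLp hu.toLp = ∫ x, u x * (starRingEnd ℂ) (v x) ∂m := by
    intro u v hu hv
    rw [L2.inner_def]
    refine integral_congr_ae ?_
    filter_upwards [hu.coeFn_toLp, hv.coeFn_toLp] with x h1 h2
    rw [h1, h2, RCLike.inner_apply]
  have hconj : ∀ u : ℝ → ℂ, volterra m n (fun x => (starRingEnd ℂ) (u x))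
      = fun x => (starRingEnd ℂ) (volterra m n u x) := by
    intro u
    ext x
    simp only [volterra, cumul]
    rw [← integral_conj]
    simp_rw [← integral_conj]
  have hs : ∀ k, s (k + 1) ^ 2 ≤ s k * s (k + 2) := by
    intro k
    have e : inner ℂ (hW (k + 1)).1.toLp (hW (k + 1)).1.toLp
        = inner ℂ (hW (k + 2)).1.toLp (hW k).1.toLp := by
      rw [hinner (hW (k + 1)).1 (hW (k + 1)).1, hinner (hW k).1 (hW (k + 2)).1]
      have hc : Integrable (fun x => (starRingEnd ℂ) ((volterra m n)^[k + 1] f x)) m :=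
        (LinearIsometryEquiv.integrable_comp_iff (RCLike.conjLIE (K := ℂ))).2
          (hW (k + 1)).integrable
      have := (hW k).integral_volterra_mul hc
      rw [hconj] at this
      simp only [← Function.iterate_succ_apply' (volterra m n)] at this
      rw [this]
      simp_rw [mul_comm]
    have h2 := norm_inner_le_norm (𝕜 := ℂ) (hW (k + 2)).1.toLp (hW k).1.toLp
    rw [← e, inner_self_eq_norm_sq_to_K, norm_pow, RCLike.norm_ofReal, abs_norm, mul_comm] at h2
    exact h2
  have hd : ∀ k, s (k + 1) ≤ ((measureUnivNNReal m : ℝ) ^ (2 : ℝ≥0∞).toReal⁻¹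
      * (∫ t, ‖f t‖ ∂m) * n.real Set.univ)
      * ((m.real Set.univ * n.real Set.univ) ^ k / k.factorial) := by
    intro k
    have hb : ∀ x, ‖(volterra m n)^[k + 1] f x‖
        ≤ (∫ t, ‖f t‖ ∂m) * m.real Set.univ ^ k
          * (n.real Set.univ ^ (k + 1) / k.factorial) := by
      intro x
      refine (norm_iterate_volterra_le hf.integrable k x).trans ?_
      have hI : 0 ≤ ∫ t, ‖f t‖ ∂m := integral_nonneg fun _ => norm_nonneg _
      refine mul_le_mul_of_nonneg_left ?_ (by positivity)
      refine (iterMass_le n (k + 1) x).trans ?_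
      gcongr
      exact Nat.le_succ k
    have h := Lp.norm_le_of_ae_bound (f := (hW (k + 1)).1.toLp)
      (C := (∫ t, ‖f t‖ ∂m) * m.real Set.univ ^ k
          * (n.real Set.univ ^ (k + 1) / k.factorial))
      (by
        have hI : 0 ≤ ∫ t, ‖f t‖ ∂m := integral_nonneg fun _ => norm_nonneg _
        positivity)
      (by
        filter_upwards [(hW (k + 1)).1.coeFn_toLp] with x hx
        rw [hx]
        exact hb x)
    refine h.trans_eq ?_
    ring
  have h1 := eq_zero_of_sq_le_mul_of_le_div_factorial (s := s) (fun k => norm_nonneg _) hs hd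
  have h2 := (Lp.eq_zero_iff_ae_eq_zero).1 (norm_eq_zero.1 h1)
  exact (hW 1).1.coeFn_toLp.symm.trans h2

theorem MomentsVanish.cumul_ae_eq_zero (hf : MomentsVanish x₀ m n f) :
    cumul m f =ᵐ[n] 0 := by
  have h := integral_volterra_mul_conj (n := n) hf.integrable hf.integral_eq_zero
  rw [integral_eq_zero_of_ae (by
    filter_upwards [hf.volterra_ae_eq_zero] with x hx
    simp [hx])] at h
  have h0 : ∫ t, ‖cumul m f t‖ ^ 2 ∂n = 0 := by
    exact_mod_cast (neg_eq_zero.1 h.symm)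
  have hint : Integrable (fun t => ‖cumul m f t‖ ^ 2) n :=
    (memLp_cumul n 2 hf.integrable).integrable_norm_pow two_ne_zero
  filter_upwards [(integral_eq_zero_iff_of_nonneg (fun _ => sq_nonneg _) hint).1 h0] with t ht
  simpa using ht

omit [IsFiniteMeasure m] [IsFiniteMeasure n] [NullSingletonClass n] in
/-- A cumulative integral that vanishes almost everywhere for a measure dominating `m` vanishes
everywhere: it is locally constant where it is nonzero, so a nonzero value would be taken on all of
`ℝ`, which forces `n = 0`, hence `m = 0`. -/
theorem cumul_eq_zero_of_ae (hmn : m ≪ n) (hf : Integrable f m) (h : cumul m f =ᵐ[n] 0) :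
    cumul m f = 0 := by
  have hc := continuous_cumul hf
  by_contra hne
  obtain ⟨x, hx⟩ := Function.ne_iff.1 hne
  have hopen : IsOpen {y | cumul m f y = cumul m f x} := by
    rw [Metric.isOpen_iff]
    intro y (hy : cumul m f y = cumul m f x)
    obtain ⟨ε, hε, hball⟩ := Metric.isOpen_iff.1 (isOpen_ne_fun hc continuous_const) y
      (show cumul m f y ≠ 0 by rw [hy]; exact hx)
    refine ⟨ε, hε, fun z hz => ?_⟩
    have hnull : m (Set.uIoc y z) = 0 := by
      refine hmn (measure_mono_null (t := {t | ¬ cumul m f t = 0}) (fun t ht => ?_) h)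
      refine hball ?_
      have hconv := (convex_ball y ε).ordConnected.uIcc_subset (Metric.mem_ball_self hε) hz
      exact hconv (Set.uIoc_subset_uIcc ht)
    change cumul m f z = _
    rw [cumul_eq_add_intervalIntegral hf y z, hy,
      intervalIntegral.intervalIntegral_eq_integral_uIoc,
      Measure.restrict_eq_zero.2 hnull]
    simp
  have huniv : {y | cumul m f y = cumul m f x} = Set.univ :=
    IsClopen.eq_univ ⟨isClosed_eq hc continuous_const, hopen⟩ ⟨x, rfl⟩
  have hn : n = 0 := by
    rw [← Measure.measure_univ_eq_zero]
    refine measure_mono_null (t := {t | ¬ cumul m f t = 0}) (fun t _ => ?_) h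
    have : cumul m f t = cumul m f x := huniv.ge (Set.mem_univ t)
    change ¬ _
    rw [this]
    exact hx
  have hm : m = 0 := by
    rw [hn] at hmn
    exact Measure.absolutelyContinuous_zero_iff.1 hmn
  exact hx (by simp [cumul, hm])

omit [NullSingletonClass m] in
theorem ae_eq_zero_of_cumul_eq_zero (hf : Integrable f m) (h : cumul m f = 0)
    (h0 : ∫ x, f x ∂m = 0) : f =ᵐ[m] 0 := by
  refine hf.ae_eq_zero_of_forall_setIntegral_eq_zero fun s hs _ => ?_
  have hb : (inferInstance : MeasurableSpace ℝ) = .generateFrom (Set.range Set.Iic) :=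
    (BorelSpace.measurable_eq (α := ℝ)).trans (borel_eq_generateFrom_Iic ℝ)
  induction s, hs using MeasurableSpace.induction_on_inter hb isPiSystem_Iic with
  | empty => simp
  | basic t ht =>
    obtain ⟨x, rfl⟩ := ht
    exact congrFun h x
  | compl t ht ih =>
    have := integral_add_compl ht hf
    rw [ih (measure_lt_top _ _), h0, zero_add] at this
    exact this
  | iUnion t hd ht ih =>
    rw [integral_iUnion ht hd hf.integrableOn]
    simp [fun i => ih i (measure_lt_top _ _)]

theorem MomentsVanish.ae_eq_zero (hmn : m ≪ n) (hf : MomentsVanish x₀ m n f) : f =ᵐ[m] 0 :=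
  ae_eq_zero_of_cumul_eq_zero hf.integrable
    (cumul_eq_zero_of_ae hmn hf.integrable hf.cumul_ae_eq_zero) hf.integral_eq_zero

end Orthogonality

/-! ### Density of the iterated integrals and of their primitives -/

section Density

variable {x₀ : ℝ} {m n : Measure ℝ} [IsFiniteMeasure m] [IsFiniteMeasure n]
  [NullSingletonClass m] [NullSingletonClass n]

/-- The conjugate of an element of the orthogonal complement has vanishing moments. -/
theorem dense_span_iterIntegral_two (hmn : m ≪ n) :
    Dense (Submodule.span ℂ (Set.range fun k =>
      ((memLp_iterIntegral (x₀ := x₀) (m := m) (n := n) m 2 k).toLp : Lp ℂ 2 m)) :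
      Set (Lp ℂ 2 m)) := by
  rw [Submodule.dense_iff_topologicalClosure_eq_top, Submodule.topologicalClosure_eq_top_iff,
    Submodule.eq_bot_iff]
  intro g hg
  have hgm : MemLp g 2 m := Lp.memLp g
  have hf : MomentsVanish x₀ m n (fun x => (starRingEnd ℂ) (g x)) := by
    refine ⟨hgm.star, fun k => ?_⟩
    have h := (Submodule.mem_orthogonal _ _).1 hg _ (Submodule.subset_span ⟨k, rfl⟩)
    rw [L2.inner_def] at h
    rw [← map_zero (starRingEnd ℂ), ← h, ← integral_conj]
    refine integral_congr_ae ?_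
    filter_upwards [(memLp_iterIntegral (x₀ := x₀) (m := m) (n := n) m 2 k).coeFn_toLp] with x hx
    rw [hx, RCLike.inner_apply, map_mul, Complex.conj_conj, mul_comm]
  rw [Lp.eq_zero_iff_ae_eq_zero]
  filter_upwards [hf.ae_eq_zero hmn] with x hx
  simpa using hx

omit [IsFiniteMeasure n] in
theorem memLp_primitive (x₀ : ℝ) (ν : Measure ℝ) [IsFiniteMeasure ν] (p : ℝ≥0∞) {h : ℝ → ℂ}
    (hh : Integrable h n) : MemLp (fun x => ∫ t in x₀..x, h t ∂n) p ν :=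
  .of_bound (hh.continuous_primitive x₀).aestronglyMeasurable _
    (Filter.Eventually.of_forall fun _ =>
      intervalIntegral.norm_integral_le_integral_norm_uIoc.trans
        (setIntegral_le_integral hh.norm (Filter.Eventually.of_forall fun _ => norm_nonneg _)))

omit [NullSingletonClass n] in
theorem integrable_of_Lp_two (h : Lp ℂ 2 n) : Integrable h n :=
  (Lp.memLp h).integrable one_le_two

omit [NullSingletonClass n] in
theorem integral_norm_le_of_Lp_two (h : Lp ℂ 2 n) :
    ∫ t, ‖h t‖ ∂n ≤ (n Set.univ ^ (1 / 2 : ℝ)).toReal * ‖h‖ := by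
  have hm := Lp.memLp h
  have h1 := eLpNorm_le_eLpNorm_mul_rpow_measure_univ (p := 1) (q := 2) one_le_two
    hm.aestronglyMeasurable
  have hr : (1 / (1 : ℝ≥0∞).toReal - 1 / (2 : ℝ≥0∞).toReal) = 1 / 2 := by norm_num
  rw [hr] at h1
  rw [integral_norm_eq_lintegral_enorm hm.aestronglyMeasurable, ← eLpNorm_one_eq_lintegral_enorm,
    Lp.norm_def, mul_comm, ← ENNReal.toReal_mul]
  exact ENNReal.toReal_mono (ENNReal.mul_ne_top hm.eLpNorm_ne_top
    (ENNReal.rpow_ne_top_of_nonneg (by norm_num) (measure_ne_top n _))) h1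

variable (x₀ m n) in
/-- The primitive `h ↦ ∫_{x₀}^x h dn` as a continuous operator from `L²(n)` to `L^p(m)`. -/
noncomputable def primitiveCLM (p : ℝ≥0∞) [Fact (1 ≤ p)] : Lp ℂ 2 n →L[ℂ] Lp ℂ p m :=
  LinearMap.mkContinuous
    { toFun := fun h => (memLp_primitive x₀ m p (integrable_of_Lp_two h)).toLp
      map_add' := by
        intro g h
        rw [← MemLp.toLp_add, MemLp.toLp_eq_toLp_iff]
        refine Filter.Eventually.of_forall fun x => ?_
        rw [Pi.add_apply, ← intervalIntegral.integral_add
          (integrable_of_Lp_two g).intervalIntegrable (integrable_of_Lp_two h).intervalIntegrable]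
        refine intervalIntegral.integral_congr_ae ?_
        filter_upwards [Lp.coeFn_add g h] with t ht _ using ht
      map_smul' := by
        intro c h
        rw [RingHom.id_apply, ← MemLp.toLp_const_smul, MemLp.toLp_eq_toLp_iff]
        refine Filter.Eventually.of_forall fun x => ?_
        rw [Pi.smul_apply, ← intervalIntegral.integral_smul]
        refine intervalIntegral.integral_congr_ae ?_
        filter_upwards [Lp.coeFn_smul c h] with t ht _ using ht }
    ((measureUnivNNReal m : ℝ) ^ p.toReal⁻¹ * (n Set.univ ^ (1 / 2 : ℝ)).toReal)
    (by
      intro h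
      rw [mul_assoc]
      refine Lp.norm_le_of_ae_bound (by positivity) ?_
      filter_upwards [(memLp_primitive x₀ m p (integrable_of_Lp_two h)).coeFn_toLp] with x hx
      refine le_trans (le_of_eq (congrArg _ hx)) ?_
      exact (intervalIntegral.norm_integral_le_integral_norm_uIoc.trans
        (setIntegral_le_integral (integrable_of_Lp_two h).norm
          (Filter.Eventually.of_forall fun _ => norm_nonneg _))).trans
        (integral_norm_le_of_Lp_two h))

omit [NullSingletonClass m] in
theorem primitiveCLM_toLp (p : ℝ≥0∞) [Fact (1 ≤ p)] {h : ℝ → ℂ} (hh : MemLp h 2 n) :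
    primitiveCLM x₀ m n p hh.toLp
      = (memLp_primitive x₀ m p (hh.integrable one_le_two)).toLp := by
  refine (MemLp.toLp_eq_toLp_iff
    (memLp_primitive x₀ m p (integrable_of_Lp_two hh.toLp)) _).2 ?_
  refine Filter.Eventually.of_forall fun x => ?_
  refine intervalIntegral.integral_congr_ae ?_
  filter_upwards [hh.coeFn_toLp] with t ht _ using ht

/-- The primitive operator maps the iterated integrals of the pair `(n, m)`, which are dense in
`L²(n)`, to those of the pair `(m, n)`. -/
theorem primitive_mem_closure_span_iterIntegral (hnm : n ≪ m) (p : ℝ≥0∞) [Fact (1 ≤ p)]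
    {h : ℝ → ℂ} (hh : MemLp h 2 n) :
    (memLp_primitive x₀ m p (hh.integrable one_le_two)).toLp ∈
      (Submodule.span ℂ (Set.range fun k =>
        ((memLp_iterIntegral (x₀ := x₀) (m := m) (n := n) m p k).toLp :
          Lp ℂ p m))).topologicalClosure := by
  rw [← primitiveCLM_toLp p hh]
  refine map_mem_closure (primitiveCLM x₀ m n p).continuous
    (dense_span_iterIntegral_two (x₀ := x₀) hnm _) fun u hu => ?_
  refine (Submodule.span_le (p := Submodule.comap (primitiveCLM x₀ m n p).toLinearMap
    (Submodule.span ℂ _))).2 ?_ hu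
  rintro _ ⟨k, rfl⟩
  refine Submodule.subset_span ⟨k + 1, ?_⟩
  exact (primitiveCLM_toLp p (memLp_iterIntegral n 2 k)).symm

end Density

/-! ### Impedance measures and formal powers -/

section Impedance

variable {I : Set ℝ} {a : ℝ → ℝ}

theorem IsProperImpedance.one_div (ha : IsProperImpedance I a) :
    IsProperImpedance I (fun x => 1 / a x) where
  pos := ha.pos.mono fun _ h => one_div_pos.2 h
  memLp := ha.memLp_inv
  memLp_inv := by simpa only [one_div_one_div] using ha.memLp

theorem IsProperImpedance.isFiniteMeasure (ha : IsProperImpedance I a) :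
    IsFiniteMeasure (impedanceMeasure I a) :=
  isFiniteMeasure_withDensity_ofReal ha.memLp.integrable_sq.2

instance impedanceMeasure.nullSingletonClass : NullSingletonClass (impedanceMeasure I a) := by
  unfold impedanceMeasure; infer_instance

theorem impedanceMeasure_absolutelyContinuous :
    impedanceMeasure I a ≪ volume.restrict I :=
  withDensity_absolutelyContinuous _ _

theorem IsProperImpedance.aemeasurable_density (ha : IsProperImpedance I a) :
    AEMeasurable (fun x => ENNReal.ofReal (a x ^ 2)) (volume.restrict I) :=
  (ha.memLp.aestronglyMeasurable.aemeasurable.pow_const 2).ennreal_ofReal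

theorem IsProperImpedance.absolutelyContinuous (ha : IsProperImpedance I a) :
    volume.restrict I ≪ impedanceMeasure I a :=
  withDensity_absolutelyContinuous' ha.aemeasurable_density <| by
    filter_upwards [ha.pos] with x hx
    simpa using hx.ne'

theorem ae_mem_of_impedanceMeasure (hI : I.OrdConnected) :
    ∀ᵐ x ∂(impedanceMeasure I a), x ∈ I :=
  impedanceMeasure_absolutelyContinuous.ae_le (ae_restrict_mem hI.measurableSet)

/-- The points `x` and `y` may be endpoints outside `I`, and `a` is unconstrained outside `I`; the
interval between them nevertheless lies in `I` up to a null set. -/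
theorem restrict_uIoc_inter_of_mem_closure (hI : I.OrdConnected) {x y : ℝ}
    (hx : x ∈ closure I) (hy : y ∈ closure I) :
    volume.restrict (Set.uIoc x y ∩ I) = volume.restrict (Set.uIoc x y) := by
  refine Measure.restrict_congr_set ?_
  have hfr : ∀ᵐ t, t ∉ frontier I :=
    measure_eq_zero_iff_ae_notMem.1 (hI.convex.addHaar_frontier volume)
  filter_upwards [hfr] with t ht
  refine propext ⟨fun h => h.1, fun h => ⟨h, ?_⟩⟩
  have hcl : t ∈ closure I :=
    hI.convex.closure.ordConnected.uIcc_subset hx hy (Set.uIoc_subset_uIcc h)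
  by_contra hn
  exact ht ⟨hcl, fun hi => hn (interior_subset hi)⟩

theorem intervalIntegral_impedanceMeasure (hI : I.OrdConnected) (ha : IsProperImpedance I a)
    {x y : ℝ} (hx : x ∈ closure I) (hy : y ∈ closure I) (v : ℝ → ℂ) :
    ∫ t in x..y, v t ∂(impedanceMeasure I a) = ∫ t in x..y, (a t ^ 2) • v t := by
  rw [intervalIntegral.intervalIntegral_eq_integral_uIoc,
    intervalIntegral.intervalIntegral_eq_integral_uIoc, impedanceMeasure,
    setIntegral_withDensity_eq_setIntegral_toReal_smul₀ ha.aemeasurable_density.restrict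
      (Filter.Eventually.of_forall fun _ => ENNReal.ofReal_lt_top) _ measurableSet_uIoc,
    Measure.restrict_restrict measurableSet_uIoc, restrict_uIoc_inter_of_mem_closure hI hx hy]
  simp_rw [ENNReal.toReal_ofReal (sq_nonneg _)]

theorem impedanceJ_eq_intervalIntegral (hI : I.OrdConnected) (ha : IsProperImpedance I a)
    {x₀ x : ℝ} (hx₀ : x₀ ∈ closure I) (hx : x ∈ closure I) (v : ℝ → ℂ) :
    impedanceJ a x₀ v x = ∫ t in x₀..x, v t ∂(impedanceMeasure I fun t => 1 / a t) := by
  rw [intervalIntegral_impedanceMeasure hI ha.one_div hx₀ hx, impedanceJ]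
  congr 1
  ext t
  rw [Complex.real_smul, div_eq_inv_mul]
  push_cast
  rw [one_div, inv_pow]

theorem impedanceJ_one_div_eq_intervalIntegral (hI : I.OrdConnected) (ha : IsProperImpedance I a)
    {x₀ x : ℝ} (hx₀ : x₀ ∈ closure I) (hx : x ∈ closure I) (v : ℝ → ℂ) :
    impedanceJ (fun t => 1 / a t) x₀ v x = ∫ t in x₀..x, v t ∂(impedanceMeasure I a) := by
  simpa only [one_div_one_div] using impedanceJ_eq_intervalIntegral hI ha.one_div hx₀ hx v

theorem formalPower_eq_factorial_mul_iterIntegral (hI : I.OrdConnected)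
    (ha : IsProperImpedance I a) {x₀ : ℝ} (hx₀ : x₀ ∈ closure I) (k : ℕ) :
    ∀ x ∈ closure I, formalPower a x₀ k x = (k.factorial : ℂ) *
      iterIntegral x₀ (impedanceMeasure I a) (impedanceMeasure I fun t => 1 / a t) k x := by
  have hsub : ∀ {x}, x ∈ closure I → Set.uIcc x₀ x ⊆ closure I := fun hx =>
    hI.convex.closure.ordConnected.uIcc_subset hx₀ hx
  induction k using Nat.twoStepInduction with
  | zero => intro x _; simp [formalPower, iterIntegral]
  | one =>
    intro x hx
    simp only [formalPower, iterIntegral, impedanceJ_eq_intervalIntegral hI ha hx₀ hx]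
    simp
  | more k ih _ =>
    intro x hx
    have hinner : ∀ t ∈ closure I, impedanceJ (fun t => 1 / a t) x₀ (formalPower a x₀ k) t
        = (k.factorial : ℂ) * iterIntegral x₀ (impedanceMeasure I fun t => 1 / a t)
          (impedanceMeasure I a) (k + 1) t := by
      intro t ht
      rw [impedanceJ_one_div_eq_intervalIntegral hI ha hx₀ ht, iterIntegral,
        ← intervalIntegral.integral_const_mul]
      exact intervalIntegral.integral_congr fun s hs => ih s (hsub ht hs)
    simp only [formalPower, impedanceR]
    rw [impedanceJ_eq_intervalIntegral hI ha hx₀ hx,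
      intervalIntegral.integral_congr fun t ht => hinner t (hsub hx ht),
      intervalIntegral.integral_const_mul]
    rw [show iterIntegral x₀ (impedanceMeasure I a) (impedanceMeasure I fun t => 1 / a t) (k + 2) x
      = ∫ t in x₀..x, iterIntegral x₀ (impedanceMeasure I fun t => 1 / a t)
        (impedanceMeasure I a) (k + 1) t ∂(impedanceMeasure I fun t => 1 / a t) from rfl,
      Nat.factorial_succ, Nat.factorial_succ]
    push_cast
    ring

theorem formalPower_ae_eq (hI : I.OrdConnected)
    (ha : IsProperImpedance I a) {x₀ : ℝ} (hx₀ : x₀ ∈ closure I) (k : ℕ) :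
    formalPower a x₀ k =ᵐ[impedanceMeasure I a] (k.factorial : ℂ) •
      iterIntegral x₀ (impedanceMeasure I a) (impedanceMeasure I fun t => 1 / a t) k := by
  filter_upwards [ae_mem_of_impedanceMeasure hI] with x hx
  exact formalPower_eq_factorial_mul_iterIntegral hI ha hx₀ k x (subset_closure hx)

/-- If `v` is bounded then `v a²` is square-integrable with respect to `dx / a²`. -/
theorem IsProperImpedance.memLp_sq_smul (ha : IsProperImpedance I a) {v : ℝ → ℂ}
    (hv : Continuous v) {C : ℝ} (hC : ∀ x, ‖v x‖ ≤ C) :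
    MemLp (fun t => (a t ^ 2) • v t) 2 (impedanceMeasure I fun t => 1 / a t) := by
  have hac := impedanceMeasure_absolutelyContinuous (I := I) (a := fun t => 1 / a t)
  have hmeas : AEStronglyMeasurable (fun t => a t ^ 2) (impedanceMeasure I fun t => 1 / a t) :=
    (ha.memLp.aestronglyMeasurable.pow 2).mono_ac hac
  have hsq : MemLp (fun t => a t ^ 2) 2 (impedanceMeasure I fun t => 1 / a t) := by
    rw [memLp_two_iff_integrable_sq hmeas, impedanceMeasure,
      integrable_withDensity_iff_integrable_smul₀' ha.one_div.aemeasurable_density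
        (Filter.Eventually.of_forall fun _ => ENNReal.ofReal_lt_top)]
    refine ha.memLp.integrable_sq.congr ?_
    filter_upwards [ha.pos] with x hx
    rw [ENNReal.toReal_ofReal (sq_nonneg _), smul_eq_mul]
    field_simp
  refine MemLp.of_le_mul (c := C) hsq (hmeas.smul hv.aestronglyMeasurable) ?_
  refine Filter.Eventually.of_forall fun x => ?_
  rw [norm_smul, mul_comm]
  exact mul_le_mul_of_nonneg_right (hC x) (norm_nonneg _)

/-- The fundamental theorem of calculus, with `dt` rewritten as `a²(t)` times the measure
`dt / a²(t)`. -/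
theorem eq_add_intervalIntegral_sq_smul_deriv (hI : I.OrdConnected) (ha : IsProperImpedance I a)
    {x₀ x : ℝ} (hx₀ : x₀ ∈ closure I) (hx : x ∈ closure I) {g : ℝ → ℂ} (hg : ContDiff ℝ 1 g) :
    g x = g x₀ + ∫ t in x₀..x, (a t ^ 2) • deriv g t ∂(impedanceMeasure I fun t => 1 / a t) := by
  rw [intervalIntegral_impedanceMeasure hI ha.one_div hx₀ hx]
  have hpos : ∀ᵐ t ∂(volume.restrict (Set.uIoc x₀ x)), 0 < a t := by
    rw [← restrict_uIoc_inter_of_mem_closure hI hx₀ hx]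
    exact ae_mono (Measure.restrict_mono Set.inter_subset_right le_rfl) ha.pos
  have hcongr : ∫ t in x₀..x, ((1 / a t) ^ 2) • (a t ^ 2) • deriv g t =
      ∫ t in x₀..x, deriv g t := by
    refine intervalIntegral.integral_congr_ae ?_
    filter_upwards [(ae_restrict_iff' measurableSet_uIoc).1 hpos] with t ht htm
    rw [smul_smul, ← mul_pow, one_div_mul_cancel (ht htm).ne', one_pow, one_smul]
  rw [hcongr, intervalIntegral.integral_deriv_eq_sub
    (fun t _ => (hg.differentiable one_ne_zero).differentiableAt)
    ((hg.continuous_deriv le_rfl).intervalIntegrable _ _)]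
  ring

end Impedance

/-! ### Completeness of the formal powers -/

theorem mainTheorem1 (I : Set ℝ) (hI : I.OrdConnected) (hIb : Bornology.IsBounded I)
    (a : ℝ → ℝ) (ha : IsProperImpedance I a) (x₀ : ℝ) (hx₀ : x₀ ∈ closure I)
    (p : ℝ≥0∞) [Fact (1 ≤ p)] (hp : p ≠ ∞) :
    ∃ h : ∀ k : ℕ, MemLp (formalPower a x₀ k) p (impedanceMeasure I a),
      IsCompleteSystem
        (fun k : ℕ => ((h k).toLp (formalPower a x₀ k) : Lp ℂ p (impedanceMeasure I a))) := by
  have := ha.isFiniteMeasure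
  have := ha.one_div.isFiniteMeasure
  set m := impedanceMeasure I a with hm
  set n := impedanceMeasure I (fun t => 1 / a t) with hn
  have hP : ∀ k, MemLp (iterIntegral x₀ m n k) p m := memLp_iterIntegral m p
  have hae := formalPower_ae_eq hI ha hx₀
  have hφ : ∀ k, MemLp (formalPower a x₀ k) p m := fun k =>
    ((hP k).const_smul (k.factorial : ℂ)).ae_eq (hae k).symm
  refine ⟨hφ, ?_⟩
  set S := Submodule.span ℂ (Set.range fun k => (hφ k).toLp) with hS
  have hPS : ∀ k, (hP k).toLp ∈ S := by
    intro k
    have h : (hφ k).toLp = (k.factorial : ℂ) • (hP k).toLp := by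
      rw [← MemLp.toLp_const_smul, MemLp.toLp_eq_toLp_iff]
      exact hae k
    have hk : (k.factorial : ℂ) ≠ 0 := Nat.cast_ne_zero.2 k.factorial_ne_zero
    rw [← inv_smul_smul₀ hk (hP k).toLp, ← h]
    exact S.smul_mem _ (Submodule.subset_span ⟨k, rfl⟩)
  have hle : (Submodule.span ℂ (Set.range fun k => (hP k).toLp)).topologicalClosure
      ≤ S.topologicalClosure := by
    refine Submodule.topologicalClosure_mono (Submodule.span_le.2 ?_)
    rintro _ ⟨k, rfl⟩
    exact hPS k
  have hnm : n ≪ m := impedanceMeasure_absolutelyContinuous.trans ha.absolutelyContinuous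
  change Dense (S : Set (Lp ℂ p m))
  rw [← dense_closure (s := (S : Set (Lp ℂ p m)))]
  -- Every class of a smooth compactly supported `g` lies in the closed span: up to the constant
  -- `g x₀` it is the primitive of `a² g'` with respect to `n`.
  refine (Lp.dense_hasCompactSupport_contDiff (E := ℝ) hp).mono ?_
  rintro f ⟨g, hfg, hgc, hgs⟩
  have hg1 : ContDiff ℝ 1 g := hgs.of_le (by norm_cast)
  have hgd := hg1.continuous_deriv le_rfl
  obtain ⟨C, hC⟩ := hgc.deriv.exists_bound_of_continuous hgd
  have hh := ha.memLp_sq_smul hgd hC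
  have hu := hle (primitive_mem_closure_span_iterIntegral (x₀ := x₀) hnm p hh)
  have hf : f = g x₀ • (hP 0).toLp
      + (memLp_primitive x₀ m p (hh.integrable one_le_two)).toLp := by
    rw [← MemLp.toLp_const_smul, ← MemLp.toLp_add]
    refine Lp.ext ((hfg.trans ?_).trans (MemLp.coeFn_toLp _).symm)
    filter_upwards [ae_mem_of_impedanceMeasure hI] with x hx
    rw [eq_add_intervalIntegral_sq_smul_deriv hI ha hx₀ (subset_closure hx) hg1]
    simp [iterIntegral]
  rw [hf]
  exact S.topologicalClosure.add_mem
    (S.topologicalClosure.smul_mem _ (S.le_topologicalClosure (hPS 0))) hu
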